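/- Let $\beta\in(1,2)$, let $f_\beta(x)=\beta x \bmod 1$ for $x\in[0,1]$, and let $d_n(x,\beta)=\lfloor \beta f_\beta^n(x)\rfloor$, $n\ge 0$, be the digits of the $\beta$-expansion of $x$. Suppose that the $\beta$-expansion of $1$ terminates, i.e. there is a $k$ with $d_n(1,\beta)=0$ for all $n\ge k$. For $x\in[0,1]$ put \[ G_{f_\beta}(x)=\Big\{\,y\in[0,1): x\notin\overline{\{f_\beta^n(y):n\ge 0\}}\,\Big\}. \] Then for every $x\in[0,1]$ and every $\alpha$ with $0<\alpha\le\frac14$ (in particular for $\alpha=\frac14$) the set $G_{f_\beta}(x)$ is $\alpha$-winning in $[0,1]$. Here, for $\alpha,\gamma\in(0,1)$, the $(\alpha,\gamma)$-game on $[0,1]$ is played as follows. Black chooses a closed interval $B_0\subset[0,1]$ of positive length, and White chooses a closed interval $W_0\subset B_0$ with $|W_0|=\alpha|B_0|$; then, at each step $k\ge1$, Black chooses a closed interval $B_k\subset W_{k-1}$ with $|B_k|=\gamma|W_{k-1}|$ and White chooses a closed interval $W_k\subset B_k$ with $|W_k|=\alpha|B_k|$. A set $E$ is $(\alpha,\gamma)$-winning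 if White has a strategy that guarantees $\bigcap_{k\ge0}W_k\subset E$ however Black plays, and $E$ is $\alpha$-winning if it is $(\alpha,\gamma)$-winning for all $\gamma\in(0,1)$. -/

import Mathlib

open Set

noncomputable section

/-- A strategy for White: given Black's moves `B 0, ..., B k`, it returns White's move at step `k`.
(White's own earlier moves are determined by the strategy and Black's moves.) Closed intervals
`[a, b]` are elements of `NonemptyInterval ℝ`, whose order is inclusion. -/
abbrev WhiteStrategy : Type :=
  (k : ℕ) → (Fin (k + 1) → NonemptyInterval ℝ) → NonemptyInterval ℝ

/-- White's move `W k` when White follows `σ` and Black plays `B 0, B 1, ...`. -/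
def WhiteStrategy.move (σ : WhiteStrategy) (B : ℕ → NonemptyInterval ℝ) (k : ℕ) :
    NonemptyInterval ℝ :=
  σ k (fun i => B i)

/-- Legality of Black's move at step `k` in the game on `[0,1]`, when White follows `σ`:
`B 0` is any closed interval of positive length in `[0,1]`, and `B (k+1)` is a closed interval
contained in `W k` of length `γ |W k|`. -/
def BlackLegal (γ : ℝ) (σ : WhiteStrategy) (B : ℕ → NonemptyInterval ℝ) : ℕ → Prop
  | 0 => 0 < (B 0).length ∧ (B 0 : Set ℝ) ⊆ Icc 0 1
  | k + 1 => (B (k + 1) : Set ℝ) ⊆ (σ.move B k : Set ℝ) ∧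
      (B (k + 1)).length = γ * (σ.move B k).length

/-- Legality of White's move at step `k`: `W k` is a closed interval contained in `B k` of length
`α |B k|`. -/
def WhiteLegal (α : ℝ) (σ : WhiteStrategy) (B : ℕ → NonemptyInterval ℝ) (k : ℕ) : Prop :=
  (σ.move B k : Set ℝ) ⊆ (B k : Set ℝ) ∧ (σ.move B k).length = α * (B k).length

/-- `E` is `(α, γ)`-winning in `[0,1]`: White has a strategy which answers legal moves of Black by
legal moves and which guarantees `⋂ k, W k ⊆ E`. -/
def IsGameWinning (α γ : ℝ) (E : Set ℝ) : Prop :=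
  ∃ σ : WhiteStrategy, ∀ B : ℕ → NonemptyInterval ℝ,
    (∀ k, (∀ j ≤ k, BlackLegal γ σ B j) → WhiteLegal α σ B k) ∧
    ((∀ k, BlackLegal γ σ B k) → (⋂ k, (σ.move B k : Set ℝ)) ⊆ E)

/-- `E` is `α`-winning in `[0,1]`: it is `(α, γ)`-winning for all `γ ∈ (0,1)`. -/
def IsAlphaWinning (α : ℝ) (E : Set ℝ) : Prop :=
  ∀ γ : ℝ, 0 < γ → γ < 1 → IsGameWinning α γ E

/-- The map `f_β(x) = β x mod 1`. -/
def betaMap (β x : ℝ) : ℝ := Int.fract (β * x)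

/-- The digits `d_n(x, β) = [β f_β^n(x)]` of the `β`-expansion of `x`. -/
def betaDigit (β x : ℝ) (n : ℕ) : ℤ := ⌊β * (betaMap β)^[n] x⌋

/-- The `β`-expansion of `1` terminates: `d(1, β) = j_0 ... j_{k-1} 0 0 0 ...` for some `k`. -/
def OneExpansionTerminates (β : ℝ) : Prop :=
  ∃ k : ℕ, ∀ n, k ≤ n → betaDigit β 1 n = 0

/-- The set `G_f(x)` of all `y ∈ [0,1)` such that `x` is not in the closure of the forward orbit
`{f^n(y) : n ≥ 0}`. -/
def orbitAvoiding (f : ℝ → ℝ) (x : ℝ) : Set ℝ :=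
  {y | y ∈ Ico (0 : ℝ) 1 ∧ x ∉ closure (range fun n : ℕ => f^[n] y)}

end

open Function

/-! ### Iterates of the `β`-map near the endpoints -/

/-! Termination makes the left orbit of `1` finite, so its points to the right of the discontinuity
`1/β` stay a fixed distance from it. Hence an interval shorter than `c β⁻ⁿ` is cut by `f^n` into at
most two affine pieces (`exists_two_affine_pieces`), and the points of it that `f^n` sends `δ`-close
to `x` form two sets of diameter at most `2δβ⁻ⁿ`. White plays in phases of `t` turns, each dealing
with the times `n` for which the current interval has just become short enough. There are `O(t)` bad
sets per phase, fewer than `2^t` for suitable `t`, and since `α ≤ 1/4` White can halve the number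
still met at each turn (`isGameWinning_of_phases`). So every phase avoids all its bad sets, and the
orbit stays `δ`-far from `x`. -/

theorem betaMap_mem_Ico (β u : ℝ) : betaMap β u ∈ Ico (0 : ℝ) 1 :=
  ⟨Int.fract_nonneg _, Int.fract_lt_one _⟩

theorem betaMap_iterate_mem_Ico {β u : ℝ} (hu : u ∈ Ico (0 : ℝ) 1) (n : ℕ) :
    (betaMap β)^[n] u ∈ Ico (0 : ℝ) 1 := by
  cases n with
  | zero => exact hu
  | succ n => rw [iterate_succ_apply']; exact betaMap_mem_Ico _ _

theorem betaMap_of_lt {β u : ℝ} (h0 : 0 ≤ β * u) (h1 : β * u < 1) : betaMap β u = β * u :=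
  Int.fract_eq_self.2 ⟨h0, h1⟩

theorem betaMap_of_le {β u : ℝ} (h1 : 1 ≤ β * u) (h2 : β * u < 2) :
    betaMap β u = β * u - 1 := by
  rw [betaMap, Int.fract_eq_iff]
  exact ⟨by linarith, by linarith, 1, by push_cast; ring⟩

theorem betaMap_iterate_of_lt {β u : ℝ} (hβ : 1 < β) (hu : 0 ≤ u) (n : ℕ) (h : β ^ n * u < 1) :
    (betaMap β)^[n] u = β ^ n * u := by
  induction n with
  | zero => simp
  | succ n ih =>
    have h0 : 0 ≤ β ^ n * u := by positivity
    have h1 : β ^ (n + 1) * u = β * (β ^ n * u) := by ring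
    rw [h1] at h ⊢
    rw [iterate_succ_apply', ih (by nlinarith)]
    exact betaMap_of_lt (by positivity) h

/-- The left-continuous version of the `β`-map. -/
noncomputable def leftBetaMap (β x : ℝ) : ℝ := if β * x ≤ 1 then β * x else β * x - 1

/-- Under zero digits the map is multiplication by `β > 1`, so a positive tail would leave `[0,1)`.
-/
theorem exists_betaMap_iterate_one_eq_zero {β : ℝ} (hβ : 1 < β) (h : OneExpansionTerminates β) :
    ∃ k, (betaMap β)^[k] 1 = 0 := by
  obtain ⟨k, hk⟩ := h
  refine ⟨k + 1, ?_⟩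
  set w := (betaMap β)^[k + 1] 1 with hw
  have hw0 : w ∈ Ico (0 : ℝ) 1 := by rw [hw, iterate_succ_apply']; exact betaMap_mem_Ico _ _
  have key : ∀ n, (betaMap β)^[n + (k + 1)] 1 = β ^ n * w := by
    intro n
    induction n with
    | zero => simp [hw]
    | succ n ih =>
      have hd := hk (n + (k + 1)) (by omega)
      rw [betaDigit, Int.floor_eq_zero_iff] at hd
      rw [show n + 1 + (k + 1) = (n + (k + 1)) + 1 by ring, iterate_succ_apply',
        betaMap_of_lt hd.1 hd.2, ih]
      ring
  by_contra hne
  have hpos : 0 < w := lt_of_le_of_ne hw0.1 (Ne.symm hne)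
  obtain ⟨n, hn⟩ := pow_unbounded_of_one_lt (1 / w) hβ
  rw [div_lt_iff₀ hpos] at hn
  have h1 : (betaMap β)^[n + (k + 1)] 1 < 1 := by
    rw [show n + (k + 1) = (n + k) + 1 by ring, iterate_succ_apply']
    exact (betaMap_mem_Ico _ _).2
  rw [key] at h1
  linarith

/-- Until the orbit of `1` first hits `0` the two maps agree. The point just before is `1/β`, which
the left-continuous map sends to `1`, so `1` is periodic. -/
theorem finite_range_leftBetaMap {β : ℝ} (hβ : 1 < β) (hβ' : β < 2)
    (h : OneExpansionTerminates β) : (range fun n => (leftBetaMap β)^[n] 1).Finite := by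
  classical
  have hex := exists_betaMap_iterate_one_eq_zero hβ h
  set k := Nat.find hex with hkdef
  have hk0 : (betaMap β)^[k] 1 = 0 := Nat.find_spec hex
  have hmin : ∀ m < k, (betaMap β)^[m] 1 ≠ 0 := fun m hm => Nat.find_min hex hm
  have hk : 0 < k := by
    rcases Nat.eq_zero_or_pos k with h' | h'
    · rw [h'] at hk0; simp at hk0
    · exact h'
  have hbd : ∀ m < k, (betaMap β)^[m] 1 ∈ Ioc (0 : ℝ) 1 := by
    intro m hm
    have hne := hmin m hm
    cases m with
    | zero => simp
    | succ m =>
      rw [iterate_succ_apply'] at hne ⊢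
      have := betaMap_mem_Ico β ((betaMap β)^[m] 1)
      exact ⟨lt_of_le_of_ne this.1 (Ne.symm hne), this.2.le⟩
  have hagree : ∀ m < k, (leftBetaMap β)^[m] 1 = (betaMap β)^[m] 1 := by
    intro m
    induction m with
    | zero => intro _; rfl
    | succ m ih =>
      intro hm
      have hb := hbd m (by omega)
      have hb' := hbd (m + 1) hm
      rw [iterate_succ_apply'] at hb' ⊢
      rw [iterate_succ_apply', ih (by omega)]
      set w := (betaMap β)^[m] 1
      have hw0 : 0 < β * w := mul_pos (by linarith) hb.1
      have hw2 : β * w < 2 := by nlinarith [hb.1, hb.2]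
      unfold leftBetaMap
      rcases lt_trichotomy (β * w) 1 with h1 | h1 | h1
      · rw [if_pos h1.le, betaMap_of_lt hw0.le h1]
      · rw [betaMap_of_le h1.ge hw2, h1] at hb'
        simp at hb'
      · rw [if_neg (not_le.2 h1), betaMap_of_le h1.le hw2]
  have hper : IsPeriodicPt (leftBetaMap β) k 1 := by
    obtain ⟨m, hm⟩ : ∃ m, k = m + 1 := ⟨k - 1, by omega⟩
    have hb := hbd m (by omega)
    have ha := hagree m (by omega)
    rw [hm, iterate_succ_apply'] at hk0
    rw [IsPeriodicPt, IsFixedPt, hm, iterate_succ_apply', ha]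
    set w := (betaMap β)^[m] 1
    have hw0 : 0 < β * w := mul_pos (by linarith) hb.1
    have hw2 : β * w < 2 := by nlinarith [hb.1, hb.2]
    have h1 : β * w = 1 := by
      rcases lt_or_ge (β * w) 1 with h1 | h1
      · rw [betaMap_of_lt hw0.le h1] at hk0; linarith
      · rw [betaMap_of_le h1 hw2] at hk0; linarith
    rw [leftBetaMap, if_pos h1.le, h1]
  refine ((Finset.range k).image fun n => (leftBetaMap β)^[n] 1).finite_toSet.subset ?_
  rintro _ ⟨n, rfl⟩
  simp only [Finset.coe_image, Finset.coe_range, mem_image, mem_Iio]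
  exact ⟨n % k, Nat.mod_lt _ hk, hper.iterate_mod_apply n⟩

/-- `p` is the left orbit of `1`; `c` is at most its gap to the right of the discontinuity, so an
orbit starting just below `1` follows `p` on the same branch. -/
theorem exists_betaMap_iterate_near_one {β : ℝ} (hβ : 1 < β) (hβ' : β < 2)
    (h : OneExpansionTerminates β) :
    ∃ c : ℝ, 0 < c ∧ c ≤ 1 ∧ ∃ p : ℕ → ℝ, ∀ n u, u ∈ Ico (0 : ℝ) 1 → β ^ n * (1 - u) ≤ c →
      (betaMap β)^[n] u = p n - β ^ n * (1 - u) := by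
  have hfin := finite_range_leftBetaMap hβ hβ' h
  obtain ⟨c, hc, hcp⟩ : ∃ c : ℝ, 0 < c ∧
      ∀ n, 1 < β * (leftBetaMap β)^[n] 1 → c ≤ β * (leftBetaMap β)^[n] 1 - 1 := by
    set S := {v | v ∈ range (fun n => (leftBetaMap β)^[n] 1) ∧ 1 < β * v} with hS
    have hSf : S.Finite := hfin.subset fun v hv => hv.1
    rcases S.eq_empty_or_nonempty with he | hne
    · refine ⟨1, one_pos, fun n hn => ?_⟩
      have : (leftBetaMap β)^[n] 1 ∈ S := ⟨⟨n, rfl⟩, hn⟩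
      simp [he] at this
    · obtain ⟨v, hv, hmin⟩ := hSf.exists_minimalFor id S hne
      refine ⟨β * v - 1, by linarith [hv.2], fun n hn => ?_⟩
      have hle : v ≤ (leftBetaMap β)^[n] 1 := by
        rcases le_total v ((leftBetaMap β)^[n] 1) with h' | h'
        · exact h'
        · exact hmin (j := (leftBetaMap β)^[n] 1) ⟨⟨n, rfl⟩, hn⟩ h'
      nlinarith
  refine ⟨min c 1, by positivity, min_le_right _ _, fun n => (leftBetaMap β)^[n] 1, ?_⟩
  intro n u hu hn
  induction n with
  | zero => simp
  | succ n ih =>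
    have h1u : 0 < 1 - u := by linarith [hu.2]
    have hpos : 0 < β ^ n * (1 - u) := by positivity
    have hexp : β ^ (n + 1) * (1 - u) = β * (β ^ n * (1 - u)) := by ring
    rw [hexp] at hn ⊢
    have ih' := ih (by nlinarith)
    have hm := betaMap_iterate_mem_Ico (β := β) hu n
    simp only [iterate_succ_apply'] at ih' ⊢
    have hcn := hcp n
    rw [ih'] at hm ⊢
    simp only [leftBetaMap]
    have hβp : 0 < β * (β ^ n * (1 - u)) := by positivity
    set e := β ^ n * (1 - u)
    set w := (leftBetaMap β)^[n] 1
    have h0 : 0 ≤ β * (w - e) := mul_nonneg (by linarith) hm.1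
    have h2 : β * (w - e) < 2 := by nlinarith [hm.1, hm.2]
    split_ifs with hw
    · rw [betaMap_of_lt h0 (by nlinarith)]; ring
    · have := hcn (not_le.1 hw)
      have := min_le_left c 1
      rw [betaMap_of_le (by nlinarith) h2]; ring

/-- On a set of diameter at most a constant times `β⁻ⁿ` the `n`-th iterate of the `β`-map is affine
on each of two pieces. -/
theorem exists_two_affine_pieces {β : ℝ} (hβ : 1 < β) (hβ' : β < 2)
    (h : OneExpansionTerminates β) :
    ∃ c : ℝ, 0 < c ∧ ∀ (n : ℕ) (I : Set ℝ), I ⊆ Ico (0 : ℝ) 1 →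
      (∀ u ∈ I, ∀ v ∈ I, β ^ n * (u - v) < c) →
      ∃ A : Set ℝ, ∀ u ∈ I, ∀ v ∈ I, (u ∈ A ↔ v ∈ A) →
        (betaMap β)^[n] u - (betaMap β)^[n] v = β ^ n * (u - v) := by
  obtain ⟨c, hc, hc1, p, hp⟩ := exists_betaMap_iterate_near_one hβ hβ' h
  refine ⟨c, hc, fun n => ?_⟩
  induction n with
  | zero => intro I _ _; exact ⟨∅, by simp⟩
  | succ n ih =>
    intro I hI hd
    have hpn : 0 < β ^ n := by positivity
    have hlow : ∀ u ∈ I, β * u < 1 → betaMap β u = β * u := fun u hu h1 =>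
      betaMap_of_lt (mul_nonneg (by linarith) (hI hu).1) h1
    have hhigh : ∀ u ∈ I, 1 ≤ β * u → betaMap β u = β * u - 1 := fun u hu h1 =>
      betaMap_of_le h1 (by nlinarith [(hI hu).1, (hI hu).2])
    by_cases hsplit : (∃ a ∈ I, β * a < 1) ∧ ∃ b ∈ I, 1 ≤ β * b
    -- If `I` straddles `1/β`, its two parts land just below `1` and just above `0`, where the
    -- remaining `n` steps cut no further.
    · obtain ⟨⟨a, ha, ha1⟩, b, hb, hb1⟩ := hsplit
      have hone : ∀ u ∈ I, β * u < 1 →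
          (betaMap β)^[n + 1] u = p n - β ^ n * (1 - β * u) := by
        intro u hu h1
        have hmem := betaMap_mem_Ico β u
        rw [iterate_succ_apply]
        rw [hlow u hu h1] at hmem ⊢
        refine hp n _ hmem ?_
        have := hd b hb u hu
        rw [pow_succ] at this
        nlinarith
      have hzero : ∀ u ∈ I, 1 ≤ β * u → (betaMap β)^[n + 1] u = β ^ n * (β * u - 1) := by
        intro u hu h1
        have hmem := betaMap_mem_Ico β u
        rw [iterate_succ_apply]
        rw [hhigh u hu h1] at hmem ⊢
        refine betaMap_iterate_of_lt hβ hmem.1 n ?_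
        have := hd u hu a ha
        rw [pow_succ] at this
        nlinarith
      refine ⟨{u | β * u < 1}, fun u hu v hv huv => ?_⟩
      simp only [mem_ofPred_eq] at huv
      by_cases h1 : β * u < 1
      · rw [hone u hu h1, hone v hv (huv.1 h1)]; ring
      · have h2 : ¬ β * v < 1 := fun h' => h1 (huv.2 h')
        rw [hzero u hu (not_lt.1 h1), hzero v hv (not_lt.1 h2)]; ring
    · have hdiff : ∀ u ∈ I, ∀ v ∈ I, betaMap β u - betaMap β v = β * (u - v) := by
        intro u hu v hv
        by_cases h1 : β * u < 1
        · have h2 : β * v < 1 := by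
            by_contra h2
            exact hsplit ⟨⟨u, hu, h1⟩, v, hv, not_lt.1 h2⟩
          rw [hlow u hu h1, hlow v hv h2]; ring
        · have h2 : ¬ β * v < 1 := fun h2 => hsplit ⟨⟨v, hv, h2⟩, u, hu, not_lt.1 h1⟩
          rw [hhigh u hu (not_lt.1 h1), hhigh v hv (not_lt.1 h2)]; ring
      obtain ⟨A, hA⟩ := ih (betaMap β '' I) (by
          rintro _ ⟨u, _, rfl⟩; exact betaMap_mem_Ico _ _) (by
          rintro _ ⟨u, hu, rfl⟩ _ ⟨v, hv, rfl⟩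
          rw [hdiff u hu v hv, ← mul_assoc, ← pow_succ]
          exact hd u hu v hv)
      refine ⟨betaMap β ⁻¹' A, fun u hu v hv huv => ?_⟩
      rw [iterate_succ_apply, iterate_succ_apply,
        hA _ ⟨u, hu, rfl⟩ _ ⟨v, hv, rfl⟩ huv, hdiff u hu v hv]
      ring

/-! ### Playing the game in phases -/

/-- The closed subinterval of relative length `α` at the left end of an interval. -/
noncomputable def leftEnd (α : ℝ) (h0 : 0 ≤ α) (B : NonemptyInterval ℝ) : NonemptyInterval ℝ where
  fst := B.fst
  snd := B.fst + α * B.length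
  fst_le_snd := by
    have : 0 ≤ α * B.length := mul_nonneg h0 (sub_nonneg.2 B.fst_le_snd)
    linarith

/-- The closed subinterval of relative length `α` at the right end of an interval. -/
noncomputable def rightEnd (α : ℝ) (h0 : 0 ≤ α) (B : NonemptyInterval ℝ) : NonemptyInterval ℝ where
  fst := B.snd - α * B.length
  snd := B.snd
  fst_le_snd := by
    have : 0 ≤ α * B.length := mul_nonneg h0 (sub_nonneg.2 B.fst_le_snd)
    linarith

open scoped Classical in
/-- The members of a finite family of sets which meet a given interval. -/
noncomputable def meeting (F : Finset (Set ℝ)) (W : NonemptyInterval ℝ) : Finset (Set ℝ) :=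
  F.filter fun s => (s ∩ (W : Set ℝ)).Nonempty

/-- The end of an interval which meets fewer members of a finite family of sets. -/
noncomputable def emptierEnd (α : ℝ) (h0 : 0 ≤ α) (F : Finset (Set ℝ)) (B : NonemptyInterval ℝ) :
    NonemptyInterval ℝ :=
  if (meeting F (leftEnd α h0 B)).card ≤ (meeting F (rightEnd α h0 B)).card
    then leftEnd α h0 B else rightEnd α h0 B

theorem meeting_mono (F : Finset (Set ℝ)) {V W : NonemptyInterval ℝ}
    (h : (V : Set ℝ) ⊆ (W : Set ℝ)) : meeting F V ⊆ meeting F W := by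
  classical
  intro s hs
  simp only [meeting, Finset.mem_filter] at hs ⊢
  exact ⟨hs.1, hs.2.mono (inter_subset_inter_right _ h)⟩

theorem emptierEnd_subset {α : ℝ} (h0 : 0 ≤ α) (h1 : α ≤ 1) (F : Finset (Set ℝ))
    (B : NonemptyInterval ℝ) : (emptierEnd α h0 F B : Set ℝ) ⊆ (B : Set ℝ) := by
  have hl : 0 ≤ B.length := sub_nonneg.2 B.fst_le_snd
  have hl' : B.length = B.snd - B.fst := rfl
  have : α * B.length ≤ B.length := mul_le_of_le_one_left hl h1
  unfold emptierEnd
  split_ifs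
  · exact Icc_subset_Icc le_rfl (by simp only [leftEnd]; linarith)
  · exact Icc_subset_Icc (by simp only [rightEnd]; linarith) le_rfl

theorem emptierEnd_length {α : ℝ} (h0 : 0 ≤ α) (F : Finset (Set ℝ)) (B : NonemptyInterval ℝ) :
    (emptierEnd α h0 F B).length = α * B.length := by
  unfold emptierEnd
  split_ifs
  · simp [leftEnd, NonemptyInterval.length]
  · simp [rightEnd, NonemptyInterval.length]

/-- The two ends are at least `B.length / 2` apart, so no set of the family meets both. -/
theorem two_mul_card_meeting_emptierEnd_le {α : ℝ} (h0 : 0 ≤ α) (h1 : α ≤ 1 / 4)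
    (F : Finset (Set ℝ)) (B : NonemptyInterval ℝ)
    (hF : ∀ s ∈ F, ∀ u ∈ s, ∀ v ∈ s, u - v < B.length / 2) :
    2 * (meeting F (emptierEnd α h0 F B)).card ≤ (meeting F B).card := by
  classical
  have hl : 0 ≤ B.length := sub_nonneg.2 B.fst_le_snd
  have hl' : B.length = B.snd - B.fst := rfl
  have hα : α * B.length ≤ B.length / 4 := by nlinarith
  have hdisj : Disjoint (meeting F (leftEnd α h0 B)) (meeting F (rightEnd α h0 B)) := by
    rw [Finset.disjoint_left]
    intro s hs hs'
    simp only [meeting, Finset.mem_filter] at hs hs'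
    obtain ⟨hsF, u, hu, huW⟩ := hs
    obtain ⟨-, v, hv, hvW⟩ := hs'
    have h2 : u ≤ B.fst + α * B.length := huW.2
    have h3 : B.snd - α * B.length ≤ v := hvW.1
    have := hF s hsF v hv u hu
    linarith
  have hsub : meeting F (leftEnd α h0 B) ∪ meeting F (rightEnd α h0 B) ⊆ meeting F B := by
    refine Finset.union_subset (meeting_mono F ?_) (meeting_mono F ?_)
    · exact Icc_subset_Icc le_rfl (by simp only [leftEnd]; linarith)
    · exact Icc_subset_Icc (by simp only [rightEnd]; linarith) le_rfl
  have hcard := Finset.card_le_card hsub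
  rw [Finset.card_union_of_disjoint hdisj] at hcard
  unfold emptierEnd
  split_ifs <;> omega

/-- The strategy which plays in phases of `t (B 0)` turns and in the phase `j`, started by Black's
move `C`, always moves to the end that meets fewer members of `F (B 0) j C`. -/
noncomputable def phaseStrategy (α : ℝ) (h0 : 0 ≤ α) (t : NonemptyInterval ℝ → ℕ)
    (F : NonemptyInterval ℝ → ℕ → NonemptyInterval ℝ → Finset (Set ℝ)) : WhiteStrategy :=
  fun k B => emptierEnd α h0
    (F (B 0) (k / t (B 0)) (B ⟨t (B 0) * (k / t (B 0)), Nat.lt_succ_of_le (Nat.mul_div_le _ _)⟩))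
    (B (Fin.last k))

theorem isGameWinning_of_phases {α γ : ℝ} (hα : 0 < α) (hα' : α ≤ 1 / 4) (hγ : 0 < γ)
    (hγ' : γ < 1) {E : Set ℝ}
    (H : ∀ B₀ : NonemptyInterval ℝ, 0 < B₀.length →
      ∃ t : ℕ, 0 < t ∧ ∃ F : ℕ → NonemptyInterval ℝ → Finset (Set ℝ),
        (∀ j, ∀ C : NonemptyInterval ℝ, C.length = (α * γ) ^ (t * j) * B₀.length →
          (F j C).card < 2 ^ t ∧
          ∀ s ∈ F j C, ∀ u ∈ s, ∀ v ∈ s, u - v < (α * γ) ^ (t * (j + 1)) * B₀.length / 2) ∧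
        ∀ C : ℕ → NonemptyInterval ℝ, (∀ j, (C j).length = (α * γ) ^ (t * j) * B₀.length) →
          ∀ y ∈ Icc (0 : ℝ) 1, (∀ j, y ∈ (C j : Set ℝ)) → (∀ j, ∀ s ∈ F j (C j), y ∉ s) →
          y ∈ E) :
    IsGameWinning α γ E := by
  classical
  have H' : ∀ B₀ : NonemptyInterval ℝ, ∃ t : ℕ,
      ∃ F : ℕ → NonemptyInterval ℝ → Finset (Set ℝ), 0 < B₀.length → 0 < t ∧
        (∀ j, ∀ C : NonemptyInterval ℝ, C.length = (α * γ) ^ (t * j) * B₀.length →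
          (F j C).card < 2 ^ t ∧
          ∀ s ∈ F j C, ∀ u ∈ s, ∀ v ∈ s, u - v < (α * γ) ^ (t * (j + 1)) * B₀.length / 2) ∧
        ∀ C : ℕ → NonemptyInterval ℝ, (∀ j, (C j).length = (α * γ) ^ (t * j) * B₀.length) →
          ∀ y ∈ Icc (0 : ℝ) 1, (∀ j, y ∈ (C j : Set ℝ)) → (∀ j, ∀ s ∈ F j (C j), y ∉ s) →
          y ∈ E := by
    -- For a degenerate `B₀` any values do: White's moves are legal whatever `t` and `F` are.
    intro B₀
    by_cases hB : 0 < B₀.length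
    · obtain ⟨t, ht, F, h⟩ := H B₀ hB
      exact ⟨t, F, fun _ => ⟨ht, h⟩⟩
    · exact ⟨0, fun _ _ => ∅, fun h => absurd h hB⟩
  choose t F hF using H'
  refine ⟨phaseStrategy α hα.le t F, fun B => ⟨fun k _ => ?_, fun hB y hy => ?_⟩⟩
  · exact ⟨emptierEnd_subset hα.le (by linarith) _ _, emptierEnd_length hα.le _ _⟩
  set σ := phaseStrategy α hα.le t F with hσ
  obtain ⟨ht, hcard, hE⟩ := hF (B 0) (hB 0).1
  set T := t (B 0)
  have hW : ∀ k, σ.move B k = emptierEnd α hα.le (F (B 0) (k / T) (B (T * (k / T)))) (B k) :=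
    fun k => rfl
  have hsub : ∀ k, (σ.move B k : Set ℝ) ⊆ (B k : Set ℝ) := fun k =>
    emptierEnd_subset hα.le (by linarith) _ _
  have hlen : ∀ k, (B k).length = (α * γ) ^ k * (B 0).length := by
    intro k
    induction k with
    | zero => simp
    | succ k ih =>
      rw [(hB (k + 1)).2, hW, emptierEnd_length, ih]
      ring
  rw [mem_iInter] at hy
  refine hE (fun j => B (T * j)) (fun j => hlen _) y ((hB 0).2 (hsub 0 (hy 0)))
    (fun j => hsub _ (hy _)) fun j s hs hys => ?_
  obtain ⟨hc, hd⟩ := hcard j (B (T * j)) (hlen _)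
  set G := F (B 0) j (B (T * j)) with hG
  have hWj : ∀ i < T, σ.move B (T * j + i) = emptierEnd α hα.le G (B (T * j + i)) := by
    intro i hi
    have hdiv : (T * j + i) / T = j := by
      rw [Nat.mul_add_div ht, Nat.div_eq_of_lt hi, add_zero]
    rw [hW, hdiv]
  have hhalf : ∀ i < T, 2 * (meeting G (σ.move B (T * j + i))).card ≤
      (meeting G (B (T * j + i))).card := by
    intro i hi
    rw [hWj i hi]
    refine two_mul_card_meeting_emptierEnd_le hα.le hα' G _ fun s hs u hu v hv => ?_
    refine (hd s hs u hu v hv).trans_le ?_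
    rw [hlen (T * j + i)]
    have hle : (α * γ) ^ (T * (j + 1)) ≤ (α * γ) ^ (T * j + i) :=
      pow_le_pow_of_le_one (by positivity) (by nlinarith) (by rw [mul_add]; omega)
    have := mul_le_mul_of_nonneg_right hle (hB 0).1.le
    linarith
  have hpow : ∀ i < T, 2 ^ (i + 1) * (meeting G (σ.move B (T * j + i))).card ≤ G.card := by
    intro i
    induction i with
    | zero =>
      intro hi
      have h1 := hhalf 0 hi
      have h2 : (meeting G (B (T * j + 0))).card ≤ G.card :=
        Finset.card_le_card (Finset.filter_subset _ _)
      omega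
    | succ i ih =>
      intro hi
      have h1 := hhalf (i + 1) hi
      have h2 := Finset.card_le_card (meeting_mono G (hB (T * j + i + 1)).1)
      have h3 := ih (by omega)
      calc 2 ^ (i + 1 + 1) * (meeting G (σ.move B (T * j + (i + 1)))).card
          = 2 ^ (i + 1) * (2 * (meeting G (σ.move B (T * j + (i + 1)))).card) := by ring
        _ ≤ 2 ^ (i + 1) * (meeting G (σ.move B (T * j + i))).card :=
          Nat.mul_le_mul_left _ (h1.trans h2)
        _ ≤ G.card := h3
  have hlast := hpow (T - 1) (by omega)
  rw [Nat.sub_add_cancel ht] at hlast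
  have hmem : s ∈ meeting G (σ.move B (T * j + (T - 1))) :=
    Finset.mem_filter.2 ⟨hs, y, hys, hy _⟩
  have hone : 1 ≤ (meeting G (σ.move B (T * j + (T - 1)))).card := Finset.card_pos.2 ⟨s, hmem⟩
  have : 2 ^ T * 1 ≤ 2 ^ T * (meeting G (σ.move B (T * j + (T - 1)))).card :=
    Nat.mul_le_mul_left _ hone
  omega

/-! ### The main theorem -/

theorem exists_threshold {β c : ℝ} (hβ : 1 < β) {r : ℝ} (hr : 0 < r) :
    ∃ N : ℕ, ∀ n, n < N ↔ β ^ n * r < c := by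
  classical
  have hex : ∃ n : ℕ, c ≤ β ^ n * r := by
    obtain ⟨n, hn⟩ := pow_unbounded_of_one_lt (c / r) hβ
    exact ⟨n, ((div_lt_iff₀ hr).1 hn).le⟩
  refine ⟨Nat.find hex, fun n => ⟨fun h => not_le.1 (Nat.find_min hex h), fun h => ?_⟩⟩
  by_contra hn
  have h1 : β ^ Nat.find hex ≤ β ^ n := pow_le_pow_right₀ hβ.le (not_lt.1 hn)
  have h2 := mul_le_mul_of_nonneg_right h1 hr.le
  linarith [Nat.find_spec hex]

theorem exists_linear_lt_two_pow (a b : ℕ) : ∃ t : ℕ, 0 < t ∧ a + b * t < 2 ^ t := by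
  have h1 : Filter.Tendsto (fun t : ℕ => ((t : ℝ) ^ 1 / 2 ^ t)) Filter.atTop (nhds 0) :=
    tendsto_pow_const_div_const_pow_of_one_lt 1 one_lt_two
  have h2 := h1.eventually (gt_mem_nhds (show (0 : ℝ) < 1 / (a + b + 1) by positivity))
  obtain ⟨t, ht, ht0⟩ := (h2.and (Filter.eventually_ge_atTop 1)).exists
  refine ⟨t, ht0, ?_⟩
  rw [pow_one, div_lt_div_iff₀ (by positivity) (by positivity)] at ht
  have h3 : t * (a + b + 1) < 1 * 2 ^ t := by exact_mod_cast ht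
  nlinarith

theorem mainTheorem3 (β : ℝ) (hβ : 1 < β) (hβ' : β < 2) (hterm : OneExpansionTerminates β)
    (x : ℝ) (hx : x ∈ Set.Icc (0 : ℝ) 1) (α : ℝ) (hα : 0 < α) (hα' : α ≤ 1 / 4) :
    IsAlphaWinning α (orbitAvoiding (betaMap β) x) := by
  classical
  intro γ hγ hγ'
  obtain ⟨c, hc, hpieces⟩ := exists_two_affine_pieces hβ hβ' hterm
  refine isGameWinning_of_phases hα hα' hγ hγ' fun B₀ hB₀ => ?_
  have hαγ : 0 < α * γ := by positivity
  have hαγ1 : α * γ < 1 := by nlinarith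
  have hthr : ∀ m : ℕ, ∃ N : ℕ, ∀ n, n < N ↔ β ^ n * ((α * γ) ^ m * B₀.length) < c :=
    fun m => exists_threshold hβ (by positivity)
  choose N hN using hthr
  -- `β ^ L` outweighs the shrinking of one turn, so each turn brings at most `L` new times.
  obtain ⟨L, hL⟩ := pow_unbounded_of_one_lt (1 / (α * γ)) hβ
  rw [div_lt_iff₀ hαγ] at hL
  have hNadd : ∀ m d, N (m + d) ≤ N m + L * d := by
    intro m d
    rw [← not_lt, hN, not_lt]
    have h1 : c ≤ β ^ N m * ((α * γ) ^ m * B₀.length) := by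
      rw [← not_lt, ← hN]; exact lt_irrefl _
    have h2 : 1 ≤ (β ^ L * (α * γ)) ^ d := one_le_pow₀ hL.le
    calc c ≤ β ^ N m * ((α * γ) ^ m * B₀.length) * 1 := by linarith
      _ ≤ β ^ N m * ((α * γ) ^ m * B₀.length) * (β ^ L * (α * γ)) ^ d := by gcongr
      _ = β ^ (N m + L * d) * ((α * γ) ^ (m + d) * B₀.length) := by
        rw [mul_pow, pow_add, pow_add, pow_mul]; ring
  obtain ⟨t, ht, htcard⟩ := exists_linear_lt_two_pow (1 + 2 * N 0) (2 * L)
  set q := (α * γ) ^ t with hq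
  have hq0 : 0 < q := by positivity
  -- The first term serves the phases `j ≥ 1`, where `β ^ n` times the previous phase's length is at
  -- least `c`; the second serves phase `0`, where only `β ^ n ≥ 1` is known.
  set δ := min (c * q ^ 2) (q * B₀.length) / 8 with hδ
  have hδ0 : 0 < δ := by positivity
  have hA : ∀ (n : ℕ) (C : NonemptyInterval ℝ), ∃ A : Set ℝ, β ^ n * C.length < c →
      ∀ u ∈ (C : Set ℝ) ∩ Ico 0 1, ∀ v ∈ (C : Set ℝ) ∩ Ico 0 1, (u ∈ A ↔ v ∈ A) →
        (betaMap β)^[n] u - (betaMap β)^[n] v = β ^ n * (u - v) := by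
    intro n C
    by_cases hC : β ^ n * C.length < c
    · obtain ⟨A, hA⟩ := hpieces n ((C : Set ℝ) ∩ Ico 0 1) inter_subset_right (by
        intro u hu v hv
        refine lt_of_le_of_lt ?_ hC
        have h1 : u ≤ C.snd := hu.1.2
        have h2 : C.fst ≤ v := hv.1.1
        have h3 : u - v ≤ C.length := by rw [NonemptyInterval.length]; linarith
        gcongr)
      exact ⟨A, fun _ => hA⟩
    · exact ⟨∅, fun h => absurd h hC⟩
  choose A hA using hA
  set lo : ℕ → ℕ := fun j => if j = 0 then 0 else N (t * (j - 1)) with hlo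
  set bad : ℕ → NonemptyInterval ℝ → Prop → Set ℝ := fun n C P =>
    {y | y ∈ (C : Set ℝ) ∩ Ico 0 1 ∧ |(betaMap β)^[n] y - x| < δ ∧ (y ∈ A n C ↔ P)} with hbad
  -- `{1}` is added because the target set lies in `[0,1)`; the factor `Prop` indexes the two affine
  -- pieces.
  refine ⟨t, ht, fun j C => insert {1}
    (((Finset.Ico (lo j) (N (t * j))) ×ˢ (Finset.univ : Finset Prop)).image
      fun z => bad z.1 C z.2), fun j C hC => ⟨?_, ?_⟩, fun C hC y hy hyC hyF => ?_⟩
  · refine (Finset.card_insert_le _ _).trans_lt ?_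
    have h1 := Finset.card_image_le (s := (Finset.Ico (lo j) (N (t * j))) ×ˢ
      (Finset.univ : Finset Prop)) (f := fun z => bad z.1 C z.2)
    rw [Finset.card_product, Nat.card_Ico, Finset.card_univ, Fintype.card_prop] at h1
    have h2 : N (t * j) - lo j ≤ N 0 + L * t := by
      rcases Nat.eq_zero_or_pos j with rfl | hj
      · rw [mul_zero]; omega
      · obtain ⟨i, rfl⟩ : ∃ i, j = i + 1 := ⟨j - 1, by omega⟩
        have := hNadd (t * i) t
        simp only [hlo, Nat.add_sub_cancel, mul_add, mul_one]
        rw [if_neg (by omega)]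
        omega
    have h3 : 1 + 2 * N 0 + 2 * L * t = 1 + (N 0 + L * t) * 2 := by ring
    rw [h3] at htcard
    omega
  · intro s hs u hu v hv
    have hpos : 0 < (α * γ) ^ (t * (j + 1)) * B₀.length / 2 := by positivity
    rcases Finset.mem_insert.1 hs with rfl | hs
    · rw [mem_singleton_iff.1 hu, mem_singleton_iff.1 hv]; simpa using hpos
    obtain ⟨⟨n, P⟩, hn, rfl⟩ := Finset.mem_image.1 hs
    rw [Finset.mem_product, Finset.mem_Ico] at hn
    obtain ⟨hun, hux, huP⟩ := hu
    obtain ⟨hvn, hvx, hvP⟩ := hv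
    have haff := hA n C (by rw [hC, ← hN]; exact hn.1.2) u hun v hvn (huP.trans hvP.symm)
    rw [abs_lt] at hux hvx
    have h1 : β ^ n * (u - v) < 2 * δ := by rw [← haff]; linarith
    have hβn : 0 < β ^ n := by positivity
    refine lt_of_mul_lt_mul_left (h1.trans_le ?_) hβn.le
    have hδ1 : 8 * δ ≤ c * q ^ 2 := by
      have := min_le_left (c * q ^ 2) (q * B₀.length); rw [hδ]; linarith
    have hδ2 : 8 * δ ≤ q * B₀.length := by
      have := min_le_right (c * q ^ 2) (q * B₀.length); rw [hδ]; linarith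
    rcases Nat.eq_zero_or_pos j with rfl | hj
    · have h2 : 1 ≤ β ^ n := one_le_pow₀ hβ.le
      rw [zero_add, mul_one, ← hq]
      have := mul_le_mul_of_nonneg_right h2 (show 0 ≤ q * B₀.length by positivity)
      linarith
    · obtain ⟨i, rfl⟩ : ∃ i, j = i + 1 := ⟨j - 1, by omega⟩
      have hni : N (t * i) ≤ n := by simpa [hlo] using hn.1.1
      rw [← not_lt, hN, not_lt] at hni
      have h2 : (α * γ) ^ (t * (i + 1 + 1)) = (α * γ) ^ (t * i) * q ^ 2 := by
        rw [hq, ← pow_mul, ← pow_add]; ring_nf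
      rw [h2]
      have := mul_le_mul_of_nonneg_right hni (sq_nonneg q)
      have h4 : β ^ n * ((α * γ) ^ (t * i) * q ^ 2 * B₀.length / 2) =
        β ^ n * ((α * γ) ^ (t * i) * B₀.length) * q ^ 2 / 2 := by ring
      rw [h4]
      linarith
  · have hy1 : y ≠ 1 := fun h => hyF 0 {1} (Finset.mem_insert_self _ _) h
    have hyI : y ∈ Ico (0 : ℝ) 1 := ⟨hy.1, lt_of_le_of_ne hy.2 hy1⟩
    refine ⟨hyI, fun hcl => ?_⟩
    obtain ⟨_, ⟨n, rfl⟩, hn⟩ := Metric.mem_closure_iff.1 hcl δ hδ0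
    rw [dist_comm, Real.dist_eq] at hn
    -- Time `n` is dealt with in the least such phase `j`; minimality gives `lo j ≤ n`.
    have hex : ∃ j, n < N (t * j) := by
      obtain ⟨j, hj⟩ := exists_pow_lt_of_lt_one
        (show 0 < c / (β ^ n * B₀.length) by positivity)
        (show q < 1 from pow_lt_one₀ hαγ.le hαγ1 (by omega))
      refine ⟨j, (hN _ _).2 ?_⟩
      rw [lt_div_iff₀ (by positivity)] at hj
      rw [pow_mul, ← hq]
      linarith
    have hlo' : lo (Nat.find hex) ≤ n := by
      rcases Nat.eq_zero_or_pos (Nat.find hex) with h0 | hpos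
      · simp [hlo, h0]
      · have := Nat.find_min hex (Nat.sub_lt hpos one_pos)
        simp only [hlo]
        rw [if_neg (by omega)]
        omega
    set j := Nat.find hex
    refine hyF j (bad n (C j) (y ∈ A n (C j))) (Finset.mem_insert_of_mem (Finset.mem_image.2
      ⟨(n, y ∈ A n (C j)), ?_, rfl⟩)) ⟨⟨hyC j, hyI⟩, hn, Iff.rfl⟩
    exact Finset.mem_product.2
      ⟨Finset.mem_Ico.2 ⟨hlo', Nat.find_spec hex⟩, Finset.mem_univ _⟩
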